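/- Let $c,\delta>0$. There is a constant $K>0$, depending only on $c$ and $\delta$, with the following property. Let $X$ be a closed (compact, connected) Riemann surface with a holomorphic 1-form $\omega$ such that the flat metric $|\omega|$ has total area $1$; write $|E|$ for the area of $E\subset X$. For $t\in\mathbb R$ let $X_t$ be the surface obtained by post-composing the natural parameters of $X$ (the local coordinates $\varphi$ with $d\varphi=\omega$, away from the zeros of $\omega$) with the map $z\mapsto e^{t/2}\,\mathrm{Re}\,z+i\,e^{-t/2}\,\mathrm{Im}\,z$, let $\omega_t$ be its 1-form, given by $d\psi$ in the resulting natural parameters $\psi$, and let $f_t:X\to X_t$ be the Teichmüller map (the identity on underlying points). A *rectangle* in $X_t$ is a holomorphic map to $X_t$ from a product of two bounded nondegenerate intervals in $\mathbb C$ (a horizontal and a vertical one) that pulls $\omega_t$ back to $dz$; it is *embedded* if this map is injective, and a *square* if its sides are equal. A rectangle is *$\delta$-buffered* if it extends in the vertical direction to a rectangle that overlaps itself at most once (every point of $X_t$ has at most two preimages in the interior of the product of intervals) and whose width times height is at least $\delta$. Let $0<\varepsilon\le1$ and $T\ge0$, and suppose that for every $t>T$ we are given a $\delta$-buffered square $A_t$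 embedded in $X_t$ with side $\sigma_t>c/t^{\varepsilon/2}$. Then there is a sequence $t_n\to\infty$ with all $t_n>T$ such that the sets $E_n=f_{t_n}^{-1}(A_{t_n})\subset X$ (preimages of the images of the squares) are measurable and satisfy (i) $|E_n\cap E_m|\le K\,|E_n|\,|E_m|$ for all $m>n$, and (ii) $\sum_n|E_n|=\infty$. -/

import Mathlib

open Set MeasureTheory Filter Topology
open scoped Manifold ENNReal

/-- A holomorphic `1`-form on a Riemann surface `X`: a `ℂ`-linear form on every tangent space whose
coefficient in every chart `z` of the atlas (the function `h` with `ω = h dz`) is holomorphic. -/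
structure HolomorphicOneForm (X : Type*) [TopologicalSpace X] [ChartedSpace ℂ X] where
  toFun : ∀ x : X, TangentSpace 𝓘(ℂ) x →L[ℂ] ℂ
  holomorphic : ∀ e ∈ atlas ℂ X, DifferentiableOn ℂ
    (fun z : ℂ => toFun (e.symm z) (mfderiv 𝓘(ℂ) 𝓘(ℂ) e.symm z (1 : ℂ))) e.target

/-- The linear map `z ↦ e^{t/2} Re z + i e^{-t/2} Im z`, as a self-homeomorphism of the plane. -/
noncomputable def teichmullerLinear (t : ℝ) : ℂ ≃ₜ ℂ where
  toFun z := ⟨Real.exp (t / 2) * z.re, Real.exp (-t / 2) * z.im⟩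
  invFun z := ⟨Real.exp (-t / 2) * z.re, Real.exp (t / 2) * z.im⟩
  left_inv z := by
    apply Complex.ext <;> simp only [← mul_assoc, ← Real.exp_add] <;> ring_nf <;> simp
  right_inv z := by
    apply Complex.ext <;> simp only [← mul_assoc, ← Real.exp_add] <;> ring_nf <;> simp
  continuous_toFun := by
    simp only [Complex.mk_eq_add_mul_I]
    fun_prop
  continuous_invFun := by
    simp only [Complex.mk_eq_add_mul_I]
    fun_prop

section Surface

variable {X : Type*} [TopologicalSpace X] [ChartedSpace ℂ X]

/-- A natural parameter of `(X, ω)`: a homeomorphism `φ` of an open set of `X` that contains no zero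
of `ω` onto an open set of the plane, with `dφ = ω`. -/
def IsNaturalParameter (ω : HolomorphicOneForm X) (φ : OpenPartialHomeomorph X ℂ) : Prop :=
  ∀ x ∈ φ.source, ω.toFun x ≠ 0 ∧ HasMFDerivAt 𝓘(ℂ) 𝓘(ℂ) φ x (ω.toFun x)

/-- The Lebesgue (area) measure of the flat metric `|ω|`: the least measure that dominates, for
every natural parameter, the planar Lebesgue measure transported to `X`. On the domain of a natural
parameter it is the transported planar measure, and the zeros of `ω` are a null set. -/
noncomputable def flatArea [MeasurableSpace X] (ω : HolomorphicOneForm X) : Measure X :=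
  ⨆ φ : {φ : OpenPartialHomeomorph X ℂ // IsNaturalParameter ω φ},
    (volume.restrict φ.1.target).map φ.1.symm

/-- The underlying space of the surface `X_t` of the Teichmüller geodesic of `(X, ω)`, which is that
of `X`; its flat structure is given by `naturalAtlas ω t`. -/
def TeichmullerSurface (_ω : HolomorphicOneForm X) (_t : ℝ) : Type _ := X

instance (ω : HolomorphicOneForm X) (t : ℝ) : TopologicalSpace (TeichmullerSurface ω t) :=
  inferInstanceAs (TopologicalSpace X)

/-- The Teichmüller map `f_t : X → X_t`. -/
def teichmullerMap (ω : HolomorphicOneForm X) (t : ℝ) : X ≃ₜ TeichmullerSurface ω t :=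
  Homeomorph.refl X

/-- The natural parameters of `X_t` (away from the zeros): those of `X`, post-composed with
`z ↦ e^{t/2} Re z + i e^{-t/2} Im z`. -/
def naturalAtlas (ω : HolomorphicOneForm X) (t : ℝ) :
    Set (OpenPartialHomeomorph (TeichmullerSurface ω t) ℂ) :=
  {ψ | ∃ φ : OpenPartialHomeomorph X ℂ, IsNaturalParameter ω φ ∧
    ψ = ((teichmullerMap ω t).symm.transOpenPartialHomeomorph φ).transHomeomorph
      (teichmullerLinear t)}

/-- A rectangle in `X_t`: a map from a product of two (open, closed or half-open) bounded
nondegenerate intervals to `X_t` such that the `1`-form `ω_t` of `X_t` pulls back to `dz`. As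
`ω_t = dψ` for a natural parameter `ψ` of `X_t`, this says that `ψ ∘ toFun` has derivative `1`; in
particular `toFun` avoids the zeros. The values of `toFun` outside `hor ×ℂ ver` are irrelevant. -/
structure FlatRectangle (ω : HolomorphicOneForm X) (t : ℝ) where
  (left right bottom top : ℝ)
  left_lt_right : left < right
  bottom_lt_top : bottom < top
  (hor ver : Set ℝ)
  Ioo_subset_hor : Ioo left right ⊆ hor
  hor_subset_Icc : hor ⊆ Icc left right
  Ioo_subset_ver : Ioo bottom top ⊆ ver
  ver_subset_Icc : ver ⊆ Icc bottom top
  toFun : ℂ → TeichmullerSurface ω t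
  continuousOn : ContinuousOn toFun (hor ×ℂ ver)
  pullback_eq : ∀ z ∈ hor ×ℂ ver, ∃ ψ ∈ naturalAtlas ω t,
    toFun z ∈ ψ.source ∧ HasDerivWithinAt (fun w => ψ (toFun w)) 1 (hor ×ℂ ver) z

namespace FlatRectangle

variable {ω : HolomorphicOneForm X} {t : ℝ}

/-- The product of intervals on which the rectangle is defined. -/
def domain (R : FlatRectangle ω t) : Set ℂ := R.hor ×ℂ R.ver

/-- The subset of `X_t` swept out by the rectangle. -/
def image (R : FlatRectangle ω t) : Set (TeichmullerSurface ω t) := R.toFun '' R.domain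

def width (R : FlatRectangle ω t) : ℝ := R.right - R.left

def height (R : FlatRectangle ω t) : ℝ := R.top - R.bottom

def IsSquare (R : FlatRectangle ω t) : Prop := R.width = R.height

def IsEmbedded (R : FlatRectangle ω t) : Prop := InjOn R.toFun R.domain

/-- `S` extends `R` in the vertical direction (upwards, downwards or both). -/
def ExtendsVertically (S R : FlatRectangle ω t) : Prop :=
  S.hor = R.hor ∧ R.ver ⊆ S.ver ∧ EqOn S.toFun R.toFun R.domain

/-- No point of the surface is covered more than twice by the rectangle (contacts along the boundary
do not count as overlaps). -/
def OverlapsAtMostOnce (R : FlatRectangle ω t) : Prop :=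
  ∀ p : TeichmullerSurface ω t, {z ∈ interior R.domain | R.toFun z = p}.encard ≤ 2

/-- `R` extends in the vertical direction to a rectangle that overlaps itself at most once and whose
dimensions have product at least `δ`. -/
def IsBuffered (R : FlatRectangle ω t) (δ : ℝ) : Prop :=
  ∃ S : FlatRectangle ω t, S.ExtendsVertically R ∧ S.OverlapsAtMostOnce ∧
    δ ≤ S.width * S.height

end FlatRectangle

end Surface

/-- The hypotheses of the Paley-Zygmund lemma with constant `K`, for a sequence of sets `E n` in a
measure space: the sets are measurable, `|E n ∩ E m| ≤ K |E n| |E m|` for all `m > n`, and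
`∑ |E n| = ∞`. -/
def PaleyZygmundConditions {Ω : Type*} [MeasurableSpace Ω] (μ : Measure Ω) (K : ℝ)
    (E : ℕ → Set Ω) : Prop :=
  (∀ n, MeasurableSet (E n)) ∧
  (∀ n m, n < m → μ (E n ∩ E m) ≤ ENNReal.ofReal K * μ (E n) * μ (E m)) ∧
  ∑' n, μ (E n) = ∞

/-!
Let `m > n`. In the flat metric of `X` the set `E_m` is a tall thin rectangle, of height
`e^{t_m/2} σ_m`. Follow a vertical segment of `E_m`. Whenever it meets `E_n`, it runs vertically
through the square `A_{t_n}`, spending there (in the metric of `X_{t_n}`) a length `σ_n`, and then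
through the rest of the buffer of `A_{t_n}`, of total height at least `δ / σ_n`. As the buffer
overlaps itself at most once, the proportion of `E_m` in `E_n` is at most
`2 σ_n / (δ / σ_n) = (2 / δ) |E_n|`, apart from the points of `E_m` so close to its horizontal sides
that the passage is not completed. The area of those points is `O(e^{-(t_m - t_n)/2} σ_m / σ_n)`, which
is `O(σ_n² σ_m²)` if `t_m - t_n ≥ 4 log t_m`, because `σ > c / √t`. The times `t_n = 12 x log x`,
`x = n + N`, have such gaps, and `∑ |E_n| ≥ c² ∑ 1 / t_n` diverges.

The passages are not counted one by one. The area of the pairs (point of `E_m ∩ E_n`, vertical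
displacement that keeps it in the buffer) is computed in two ways by Tonelli's theorem
(`volume_shear_le`, `flatArea_image_inter_le`). Following a vertical segment in both rectangles is
unique continuation of flat maps (`IsFlatOn.apply_add_eq`). The computation takes place in the plane,
since injective flat maps preserve area (`IsFlatOn.flatArea_image_eq`).
-/

/-! ### Flat maps to the surface -/

section FlatMaps

variable {X : Type*} [TopologicalSpace X] [ChartedSpace ℂ X] {ω : HolomorphicOneForm X}

theorem IsNaturalParameter.hasDerivAt_transition {φ φ' : OpenPartialHomeomorph X ℂ}
    (hφ : IsNaturalParameter ω φ) (hφ' : IsNaturalParameter ω φ') {x : X}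
    (hx : x ∈ φ.source) (hx' : x ∈ φ'.source) : HasDerivAt (φ' ∘ φ.symm) 1 (φ x) := by
  set e := chartAt ℂ x with he
  have hxe : x ∈ e.source := mem_chart_source ℂ x
  let l : ℂ →L[ℂ] ℂ := ω.toFun x
  have ha0 : l 1 ≠ 0 := by
    intro h
    refine (hφ x hx).1 (show l = 0 from ContinuousLinearMap.ext fun v => ?_)
    have : l v = v * l 1 := by rw [← smul_eq_mul, ← map_smul, smul_eq_mul, mul_one]
    rw [this, h, mul_zero, zero_apply]
  have key : ∀ χ : OpenPartialHomeomorph X ℂ, IsNaturalParameter ω χ → x ∈ χ.source →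
      HasDerivAt (χ ∘ e.symm) (l 1) (e x) := by
    intro χ hχ hxχ
    have h : HasFDerivWithinAt (χ ∘ e.symm) l (range (𝓘(ℂ) : ℂ → ℂ)) (e x) := (hχ x hxχ).2.2
    rw [modelWithCornersSelf_coe, range_id, hasFDerivWithinAt_univ] at h
    exact h.hasDerivAt
  have hF : HasDerivAt (e.symm.trans φ).symm (l 1)⁻¹ (φ x) := by
    refine (e.symm.trans φ).hasDerivAt_symm ?_ ha0 ?_
    · simp [hx, hxe]
    · simpa [hx, hxe] using key φ hφ hx
  have hcomp : HasDerivAt ((φ' ∘ e.symm) ∘ (e.symm.trans φ).symm) (l 1 * (l 1)⁻¹) (φ x) := by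
    refine HasDerivAt.comp (φ x) ?_ hF
    simpa [hx, hxe] using key φ' hφ' hx'
  rw [mul_inv_cancel₀ ha0] at hcomp
  refine hcomp.congr_of_eventuallyEq ?_
  have h1 : φ.symm ⁻¹' e.source ∈ 𝓝 (φ x) := by
    refine (φ.continuousAt_symm (φ.map_source hx)).preimage_mem_nhds ?_
    rw [φ.left_inv hx]
    exact e.open_source.mem_nhds hxe
  filter_upwards [h1] with y hy
  simp [e.left_inv hy]

/-- `f` is a flat map from `D ⊆ ℂ` to `(X, ω)`: it is continuous on `D` and pulls `ω` back to `dz`,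
that is, it has derivative `1` when read in natural parameters. The derivative is taken over `ℝ`, so
that the notion can be compared with natural parameters of `X_t`, and within `D`, which need not be
open. -/
def IsFlatOn (ω : HolomorphicOneForm X) (f : ℂ → X) (D : Set ℂ) : Prop :=
  ContinuousOn f D ∧ ∀ z ∈ D, ∃ φ : OpenPartialHomeomorph X ℂ, IsNaturalParameter ω φ ∧
    f z ∈ φ.source ∧ HasFDerivWithinAt (φ ∘ f) (ContinuousLinearMap.id ℝ ℂ) D z

namespace IsFlatOn

variable {f g : ℂ → X} {D D' : Set ℂ}

theorem mono (hf : IsFlatOn ω f D) (h : D' ⊆ D) : IsFlatOn ω f D' :=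
  ⟨hf.1.mono h, fun z hz => by
    obtain ⟨φ, h1, h2, h3⟩ := hf.2 z (h hz)
    exact ⟨φ, h1, h2, h3.mono h⟩⟩

/-- A flat map has derivative `1` in every natural parameter, since transition maps between natural
parameters have derivative `1`. -/
theorem hasFDerivWithinAt (hf : IsFlatOn ω f D) {φ : OpenPartialHomeomorph X ℂ}
    (hφ : IsNaturalParameter ω φ) {z : ℂ} (hz : z ∈ D) (hzφ : f z ∈ φ.source) :
    HasFDerivWithinAt (φ ∘ f) (ContinuousLinearMap.id ℝ ℂ) D z := by
  obtain ⟨ψ, hψ, hzψ, hd⟩ := hf.2 z hz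
  have ht := (hψ.hasDerivAt_transition hφ hzψ hzφ).hasFDerivAt.restrictScalars ℝ
  have hc := ht.comp_hasFDerivWithinAt (f := ψ ∘ f) z hd
  have hmem : f ⁻¹' ψ.source ∈ 𝓝[D] z :=
    (hf.1 z hz).preimage_mem_nhdsWithin (ψ.open_source.mem_nhds hzψ)
  refine (hc.congr_of_eventuallyEq ?_ ?_).congr_fderiv ?_
  · filter_upwards [hmem] with w hw
    simp [ψ.left_inv hw]
  · simp [ψ.left_inv hzψ]
  · ext; simp

theorem comp_add_left (hf : IsFlatOn ω f D) (a : ℂ) :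
    IsFlatOn ω (fun v => f (a + v)) ((fun v => a + v) ⁻¹' D) := by
  refine ⟨hf.1.comp (by fun_prop) (mapsTo_preimage _ _), fun z hz => ?_⟩
  obtain ⟨φ, h1, h2, h3⟩ := hf.2 (a + z) hz
  refine ⟨φ, h1, h2, ?_⟩
  have h4 : HasFDerivWithinAt (fun v : ℂ => a + v) (ContinuousLinearMap.id ℝ ℂ)
      ((fun v => a + v) ⁻¹' D) z := (hasFDerivWithinAt_id z _).const_add a
  exact (h3.comp z h4 (mapsTo_preimage _ _)).congr_fderiv (by ext; simp)

/-- Unique continuation: read in a natural parameter, two flat maps differ locally by a constant. -/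
theorem eqOn_of_isPreconnected [T2Space X] {V : Set ℂ} (hV : IsOpen V) (hVc : IsPreconnected V)
    (hf : IsFlatOn ω f V) (hg : IsFlatOn ω g V) {z : ℂ} (hz : z ∈ V) (hfg : f z = g z) :
    EqOn f g V := by
  have hfc : ∀ v ∈ V, ContinuousAt f v := fun v hv => hf.1.continuousAt (hV.mem_nhds hv)
  have hgc : ∀ v ∈ V, ContinuousAt g v := fun v hv => hg.1.continuousAt (hV.mem_nhds hv)
  suffices V ⊆ {v | v ∈ V ∧ f v = g v} from fun v hv => (this hv).2
  refine hVc.subset_of_closure_inter_subset ?_ ⟨z, hz, hz, hfg⟩ ?_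
  · rw [isOpen_iff_mem_nhds]
    rintro v ⟨hv, hvfg⟩
    obtain ⟨φ, hφ, hvφ, -⟩ := hf.2 v hv
    have hN : V ∩ (f ⁻¹' φ.source ∩ g ⁻¹' φ.source) ∈ 𝓝 v :=
      inter_mem (hV.mem_nhds hv) (inter_mem
        ((hfc v hv).preimage_mem_nhds (φ.open_source.mem_nhds hvφ))
        ((hgc v hv).preimage_mem_nhds (φ.open_source.mem_nhds (hvfg ▸ hvφ))))
    obtain ⟨r, hr, hball⟩ := Metric.mem_nhds_iff.1 hN
    refine mem_of_superset (Metric.ball_mem_nhds v hr) fun w hw => ⟨(hball hw).1, ?_⟩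
    have hd : ∀ u ∈ Metric.ball v r, HasFDerivAt (fun u => φ (f u) - φ (g u)) (0 : ℂ →L[ℝ] ℂ) u := by
      intro u hu
      obtain ⟨huV, huf, hug⟩ := hball hu
      have h1 := (hf.hasFDerivWithinAt hφ huV huf).hasFDerivAt (hV.mem_nhds huV)
      have h2 := (hg.hasFDerivWithinAt hφ huV hug).hasFDerivAt (hV.mem_nhds huV)
      simpa using! h1.sub h2
    have hconst := Metric.isOpen_ball.is_const_of_fderiv_eq_zero (𝕜 := ℝ)
      (convex_ball v r).isPreconnected
      (fun u hu => (hd u hu).differentiableAt.differentiableWithinAt)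
      (fun u hu => (hd u hu).fderiv) hw (Metric.mem_ball_self hr)
    simp only [hvfg, sub_self] at hconst
    exact φ.injOn (hball hw).2.1 (hball hw).2.2 (sub_eq_zero.1 hconst)
  · rintro v ⟨hv, hvV⟩
    refine ⟨hvV, ?_⟩
    have : (𝓝[{v | v ∈ V ∧ f v = g v}] v).NeBot := mem_closure_iff_nhdsWithin_neBot.1 hv
    refine tendsto_nhds_unique_of_eventuallyEq
      ((hfc v hvV).mono_left (nhdsWithin_le_nhds (s := {v | v ∈ V ∧ f v = g v})))
      ((hgc v hvV).mono_left nhdsWithin_le_nhds) ?_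
    filter_upwards [self_mem_nhdsWithin] with w hw using hw.2

/-- Two flat maps that agree at a point of each agree after moving both points by the same
vector `v`, as long as both stay in their convex domains. -/
theorem apply_add_eq [T2Space X] (hf : IsFlatOn ω f D) (hg : IsFlatOn ω g D')
    (hD : IsOpen D) (hD' : IsOpen D') (hDc : Convex ℝ D) (hDc' : Convex ℝ D') {z w v : ℂ}
    (hz : z ∈ D) (hw : w ∈ D') (hfg : f z = g w) (hzv : z + v ∈ D) (hwv : w + v ∈ D') :
    f (z + v) = g (w + v) := by
  set V : Set ℂ := (fun v => z + v) ⁻¹' D ∩ (fun v => w + v) ⁻¹' D'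
  have hV : IsOpen V := (hD.preimage (by fun_prop)).inter (hD'.preimage (by fun_prop))
  have hVc : Convex ℝ V := (hDc.translate_preimage_right z).inter (hDc'.translate_preimage_right w)
  exact eqOn_of_isPreconnected hV hVc.isPreconnected
    ((hf.comp_add_left z).mono inter_subset_left) ((hg.comp_add_left w).mono inter_subset_right)
    (z := 0) ⟨by simpa using hz, by simpa using hw⟩ (by simpa using hfg) ⟨hzv, hwv⟩

end IsFlatOn

end FlatMaps

/-! ### The flat area -/

section FlatArea

theorem ContinuousOn.measurableSet_inter_preimage {α β : Type*} [TopologicalSpace α]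
    [MeasurableSpace α] [BorelSpace α] [TopologicalSpace β] [MeasurableSpace β] [BorelSpace β]
    {f : α → β} {s : Set α} (hf : ContinuousOn f s) (hs : MeasurableSet s) {t : Set β}
    (ht : MeasurableSet t) : MeasurableSet (s ∩ f ⁻¹' t) := by
  have h := hs.subtype_image ((continuousOn_iff_continuous_domRestrict.1 hf).measurable ht)
  rwa [show (Subtype.val '' (s.domRestrict f ⁻¹' t)) = s ∩ f ⁻¹' t by
    rw [domRestrict_eq, preimage_comp, Subtype.image_preimage_coe]] at h

theorem OpenPartialHomeomorph.map_symm_volume_apply {X : Type*} [TopologicalSpace X]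
    [MeasurableSpace X] [BorelSpace X] (φ : OpenPartialHomeomorph X ℂ) {C : Set X}
    (hC : MeasurableSet C) :
    (volume.restrict φ.target).map φ.symm C = volume (φ '' (φ.source ∩ C)) := by
  rw [Measure.map_apply_of_aemeasurable
    (φ.continuousOn_symm.aemeasurable φ.open_target.measurableSet) hC,
    Measure.restrict_apply' φ.open_target.measurableSet, φ.image_source_inter_eq', inter_comm]

theorem OpenPartialHomeomorph.measurableSet_image {X : Type*} [TopologicalSpace X]
    [MeasurableSpace X] [BorelSpace X] (φ : OpenPartialHomeomorph X ℂ) {C : Set X}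
    (hC : MeasurableSet C) : MeasurableSet (φ '' (φ.source ∩ C)) := by
  rw [φ.image_source_inter_eq']
  exact φ.continuousOn_symm.measurableSet_inter_preimage φ.open_target.measurableSet hC

variable {X : Type*} [TopologicalSpace X] [ChartedSpace ℂ X] {ω : HolomorphicOneForm X}

theorem IsNaturalParameter.isFlatOn_symm {φ : OpenPartialHomeomorph X ℂ}
    (hφ : IsNaturalParameter ω φ) : IsFlatOn ω φ.symm φ.target := by
  refine ⟨φ.continuousOn_symm, fun z hz => ⟨φ, hφ, φ.map_target hz, ?_⟩⟩
  exact (hasFDerivWithinAt_id z φ.target).congr (fun w hw => by simp [φ.right_inv hw])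
    (by simp [φ.right_inv hz])

theorem IsFlatOn.volume_image_eq_of_subset_source {f : ℂ → X} {D U : Set ℂ} (hf : IsFlatOn ω f D)
    {φ : OpenPartialHomeomorph X ℂ} (hφ : IsNaturalParameter ω φ) (hU : MeasurableSet U)
    (hUD : U ⊆ D) (hinj : InjOn f U) (hUφ : MapsTo f U φ.source) :
    volume (φ '' (f '' U)) = volume U := by
  rw [← image_comp, ← lintegral_abs_det_fderiv_eq_addHaar_image volume hU
    (f' := fun _ => ContinuousLinearMap.id ℝ ℂ)
    (fun z hz => ((hf.mono hUD).hasFDerivWithinAt hφ hz (hUφ hz))) (φ.injOn.comp hinj hUφ)]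
  simp [ContinuousLinearMap.det]

variable [MeasurableSpace X] [BorelSpace X]

/-- On the domain of a natural parameter the flat area is the planar area. The supremum in the
definition is taken over a possibly uncountable family; it is bounded by the measure that is the
planar area on the domain of `φ` and the flat area off it, since any other natural parameter
induces the same measure on the common domain. -/
theorem flatArea_apply_of_subset_source {φ : OpenPartialHomeomorph X ℂ}
    (hφ : IsNaturalParameter ω φ) {C : Set X} (hC : MeasurableSet C) (hCφ : C ⊆ φ.source) :
    flatArea ω C = volume (φ '' C) := by
  have hCφ' : φ.source ∩ C = C := inter_eq_right.2 hCφ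
  refine le_antisymm ?_ ?_
  · have hle : flatArea ω ≤ (volume.restrict φ.target).map φ.symm +
        (flatArea ω).restrict φ.sourceᶜ := by
      refine iSup_le fun ⟨ψ, hψ⟩ => Measure.le_iff.2 fun B hB => ?_
      rw [← measure_inter_add_sdiff B φ.open_source.measurableSet, Measure.add_apply]
      refine add_le_add ?_ ?_
      · have hB' := hB.inter φ.open_source.measurableSet
        have hsub : ψ.source ∩ (B ∩ φ.source) ⊆ φ.source := fun x hx => hx.2.2
        have hm := (ψ.open_source.measurableSet).inter hB'
        rw [ψ.map_symm_volume_apply hB', φ.map_symm_volume_apply hB,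
          ← hψ.isFlatOn_symm.volume_image_eq_of_subset_source hφ (ψ.measurableSet_image hB')
            (image_subset_iff.2 fun x hx => ψ.map_source hx.1)
            (ψ.symm.injOn.mono (image_subset_iff.2 fun x hx => ψ.map_source hx.1))
            (mapsTo_image_iff.2 fun x hx => by simpa [ψ.left_inv hx.1] using hx.2.2)]
        refine measure_mono (image_mono ?_)
        rintro _ ⟨_, ⟨x, hx, rfl⟩, rfl⟩
        rw [ψ.left_inv hx.1]
        exact ⟨hx.2.2, hx.2.1⟩
      · rw [Measure.restrict_apply hB, ← sdiff_eq]
        exact Measure.le_iff'.1 (le_iSup (fun ψ : {ψ : OpenPartialHomeomorph X ℂ //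
          IsNaturalParameter ω ψ} => (volume.restrict ψ.1.target).map ψ.1.symm) ⟨ψ, hψ⟩) _
    refine (Measure.le_iff'.1 hle C).trans ?_
    rw [Measure.add_apply, φ.map_symm_volume_apply hC, Measure.restrict_apply hC,
      hCφ', ← sdiff_eq, sdiff_eq_empty.2 hCφ, measure_empty, add_zero]
  · refine le_trans ?_ (Measure.le_iff'.1 (le_iSup (fun ψ : {ψ : OpenPartialHomeomorph X ℂ //
      IsNaturalParameter ω ψ} => (volume.restrict ψ.1.target).map ψ.1.symm) ⟨φ, hφ⟩) C)
    rw [φ.map_symm_volume_apply hC, hCφ']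

namespace IsFlatOn

variable [T2Space X] {f : ℂ → X} {D U : Set ℂ}

theorem measurableSet_image (hf : IsFlatOn ω f D) (hU : MeasurableSet U) (hUD : U ⊆ D)
    (hinj : InjOn f U) : MeasurableSet (f '' U) :=
  hU.image_of_continuousOn_injOn (hf.1.mono hUD) hinj

/-- An injective flat map preserves area: its domain is a countable disjoint union of pieces that
it maps into domains of natural parameters. -/
theorem flatArea_image_eq [SecondCountableTopology X] (hf : IsFlatOn ω f D)
    (hU : MeasurableSet U) (hUD : U ⊆ D) (hinj : InjOn f U) :
    flatArea ω (f '' U) = volume U := by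
  obtain ⟨T, hTc, hT⟩ := TopologicalSpace.isOpen_iUnion_countable
    (fun φ : {φ : OpenPartialHomeomorph X ℂ // IsNaturalParameter ω φ} => φ.1.source)
    (fun φ => φ.1.open_source)
  rcases U.eq_empty_or_nonempty with rfl | ⟨z₀, hz₀⟩
  · simp
  have hcov : ∀ z ∈ U, ∃ φ ∈ T, f z ∈ φ.1.source := by
    intro z hz
    obtain ⟨φ, hφ, hzφ, -⟩ := hf.2 z (hUD hz)
    have : f z ∈ ⋃ i ∈ T, i.1.source := hT ▸ mem_iUnion.2 ⟨⟨φ, hφ⟩, hzφ⟩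
    simpa only [mem_iUnion, exists_prop] using this
  have hTne : T.Nonempty := (hcov z₀ hz₀).imp fun _ h => h.1
  obtain ⟨e, rfl⟩ := hTc.exists_eq_range hTne
  set P : ℕ → Set ℂ := disjointed fun n => U ∩ f ⁻¹' (e n).1.source
  have hQm : ∀ n, MeasurableSet (U ∩ f ⁻¹' (e n).1.source) := fun n =>
    (hf.1.mono hUD).measurableSet_inter_preimage hU (e n).1.open_source.measurableSet
  have hPm : ∀ n, MeasurableSet (P n) := fun n => MeasurableSet.disjointed hQm n
  have hPsub : ∀ n, P n ⊆ U ∩ f ⁻¹' (e n).1.source := fun n => disjointed_subset _ n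
  have hPd : Pairwise (Function.onFun Disjoint P) := disjoint_disjointed _
  have hPU : ⋃ n, P n = U := by
    rw [iUnion_disjointed]
    refine (iUnion_subset fun n => inter_subset_left).antisymm fun z hz => ?_
    obtain ⟨φ, ⟨n, rfl⟩, h⟩ := hcov z hz
    exact mem_iUnion.2 ⟨n, hz, h⟩
  have hPinj : ∀ n, InjOn f (P n) := fun n => hinj.mono fun z hz => (hPsub n hz).1
  have himg : ∀ n, MeasurableSet (f '' P n) := fun n =>
    hf.measurableSet_image (hPm n) (fun z hz => hUD (hPsub n hz).1) (hPinj n)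
  have himgd : Pairwise (Function.onFun Disjoint fun n => f '' P n) := fun m n hmn =>
    disjoint_left.2 (by
      rintro _ ⟨a, ha, rfl⟩ ⟨b, hb, hab⟩
      have := hinj (hPsub n hb).1 (hPsub m ha).1 hab
      exact disjoint_left.1 (hPd hmn) ha (this ▸ hb))
  rw [← hPU, image_iUnion, measure_iUnion himgd himg, measure_iUnion hPd hPm]
  refine tsum_congr fun n => ?_
  have hmaps : MapsTo f (P n) (e n).1.source := fun z hz => (hPsub n hz).2
  rw [flatArea_apply_of_subset_source (e n).2 (himg n) hmaps.image_subset,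
    hf.volume_image_eq_of_subset_source (e n).2 (hPm n) (fun z hz => hUD (hPsub n hz).1)
      (hPinj n) hmaps]

end IsFlatOn

end FlatArea

/-! ### Overlap of two flat rectangles -/

section Overlap

theorem Complex.volume_reProdIm (s t : Set ℝ) : volume (s ×ℂ t) = volume s * volume t := by
  rw [← Measure.prod_prod, ← Measure.volume_eq_prod,
    ← Complex.volume_preserving_equiv_real_prod.measure_preimage_equiv]
  rfl

/-- A double counting principle for a set `W` of pairs `(z, u)` of a point and a vertical displacement
`u`: if for every `z ∈ Y` the displacements from `z` have measure at least `a`, for every `z ∈ R` the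
displacements that end at `z` have measure at most `b`, and all of them end in `R`, then
`a |Y| ≤ b |R|`. It holds because every vertical translation preserves area. -/
theorem volume_shear_le {W : Set (ℂ × ℝ)} (hW : MeasurableSet W) {R Y : Set ℂ}
    (hR : MeasurableSet R) (hY : MeasurableSet Y) {a b : ℝ≥0∞}
    (hlow : ∀ z ∈ Y, a ≤ volume {u : ℝ | (z, u) ∈ W})
    (hup : ∀ z ∈ R, volume {u : ℝ | (z - u * Complex.I, u) ∈ W} ≤ b)
    (hout : ∀ z ∉ R, {u : ℝ | (z - u * Complex.I, u) ∈ W} = ∅) :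
    a * volume Y ≤ b * volume R := by
  have hF : Measurable (W.indicator (fun _ => (1 : ℝ≥0∞))) := measurable_const.indicator hW
  have hshear : Measurable fun p : ℂ × ℝ => (p.1 - p.2 * Complex.I, p.2) := by fun_prop
  have hvol : ∀ z : ℂ, ∫⁻ u : ℝ, W.indicator (fun _ => (1 : ℝ≥0∞)) (z, u) =
      volume {u : ℝ | (z, u) ∈ W} := fun z =>
    lintegral_indicator_one (measurable_prodMk_left hW)
  have hvol' : ∀ z : ℂ, ∫⁻ u : ℝ, W.indicator (fun _ => (1 : ℝ≥0∞)) (z - u * Complex.I, u) =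
      volume {u : ℝ | (z - u * Complex.I, u) ∈ W} := fun z =>
    lintegral_indicator_one (measurable_prodMk_left (hshear hW))
  calc a * volume Y = ∫⁻ z in Y, a := by rw [setLIntegral_const]
    _ ≤ ∫⁻ z in Y, ∫⁻ u : ℝ, W.indicator (fun _ => (1 : ℝ≥0∞)) (z, u) :=
        setLIntegral_mono' hY fun z hz => (hlow z hz).trans (hvol z).ge
    _ ≤ ∫⁻ z : ℂ, ∫⁻ u : ℝ, W.indicator (fun _ => (1 : ℝ≥0∞)) (z, u) :=
        setLIntegral_le_lintegral _ _
    _ = ∫⁻ u : ℝ, ∫⁻ z : ℂ, W.indicator (fun _ => (1 : ℝ≥0∞)) (z, u) :=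
        lintegral_lintegral_swap hF.aemeasurable
    _ = ∫⁻ u : ℝ, ∫⁻ z : ℂ, W.indicator (fun _ => (1 : ℝ≥0∞)) (z - u * Complex.I, u) :=
        lintegral_congr fun u => (lintegral_sub_right_eq_self
          (fun z : ℂ => W.indicator (fun _ => (1 : ℝ≥0∞)) (z, u)) (u * Complex.I)).symm
    _ = ∫⁻ z : ℂ, ∫⁻ u : ℝ, W.indicator (fun _ => (1 : ℝ≥0∞)) (z - u * Complex.I, u) :=
        (lintegral_lintegral_swap
          (f := fun (z : ℂ) (u : ℝ) => W.indicator (fun _ => (1 : ℝ≥0∞)) (z - u * Complex.I, u))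
          (hF.comp hshear).aemeasurable).symm
    _ ≤ ∫⁻ z : ℂ, R.indicator (fun _ => b) z := by
        refine lintegral_mono fun z => ?_
        rw [hvol' z]
        by_cases hz : z ∈ R
        · simpa [hz] using hup z hz
        · simp [hz, hout z hz]
    _ = b * volume R := by rw [lintegral_indicator hR, setLIntegral_const]

variable {X : Type*} [TopologicalSpace X] [ChartedSpace ℂ X] {ω : HolomorphicOneForm X}
  [MeasurableSpace X] [BorelSpace X] [T2Space X]

/-- The area of the intersection of the images of two flat rectangles, of which the first extends
vertically, to a rectangle that covers no point more than twice and has height at least `L`.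

A point of the second rectangle that lies in the first one and is at distance at least `L` from the
horizontal sides can be moved vertically, along both rectangles simultaneously, over a range of
displacements of length `L`. Conversely, a given endpoint has at most two positions in the extended
rectangle, and for each of them the displacements form an interval of length at most the height of
the first rectangle. Double counting bounds the first term; the second one accounts for the points
near the horizontal sides. -/
theorem flatArea_image_inter_le [SecondCountableTopology X] {f g G : ℂ → X}
    {l₁ r₁ b₁ p₁ B P l₂ r₂ b₂ p₂ L : ℝ}
    (hf : IsFlatOn ω f (Ioo l₂ r₂ ×ℂ Ioo b₂ p₂)) (hfi : InjOn f (Ioo l₂ r₂ ×ℂ Ioo b₂ p₂))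
    (hG : IsFlatOn ω G (Ioo l₁ r₁ ×ℂ Ioo B P)) (hgi : InjOn g (Ioo l₁ r₁ ×ℂ Ioo b₁ p₁))
    (hgG : EqOn G g (Ioo l₁ r₁ ×ℂ Ioo b₁ p₁)) (hBb : B ≤ b₁) (hpP : p₁ ≤ P)
    (hG2 : ∀ x, {z ∈ Ioo l₁ r₁ ×ℂ Ioo B P | G z = x}.encard ≤ 2)
    (hlr : l₂ ≤ r₂) (hbp : b₂ ≤ p₂) (hbp₁ : b₁ ≤ p₁) (hL : p₁ - b₁ ≤ L) (hLP : L ≤ P - B) :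
    ENNReal.ofReal L *
        flatArea ω (g '' (Ioo l₁ r₁ ×ℂ Ioo b₁ p₁) ∩ f '' (Ioo l₂ r₂ ×ℂ Ioo b₂ p₂)) ≤
      ENNReal.ofReal
        (2 * (p₁ - b₁) * ((r₂ - l₂) * (p₂ - b₂)) + L * (2 * ((r₂ - l₂) * L))) := by
  set R₁ : Set ℂ := Ioo l₁ r₁ ×ℂ Ioo b₁ p₁ with hR₁
  set R₂ : Set ℂ := Ioo l₂ r₂ ×ℂ Ioo b₂ p₂ with hR₂
  set S : Set ℂ := Ioo l₁ r₁ ×ℂ Ioo B P with hS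
  have hL0 : 0 ≤ L := by linarith
  -- cut the extended rectangle down to height `L`, keeping `R₁` inside
  obtain ⟨s₀, s₁, hs, hBs, hsb, hps, hsP⟩ : ∃ s₀ s₁, s₁ - s₀ = L ∧ B ≤ s₀ ∧ s₀ ≤ b₁ ∧ p₁ ≤ s₁ ∧
      s₁ ≤ P := by
    rcases le_total B (p₁ - L) with h | h
    · exact ⟨p₁ - L, p₁, by ring, h, by linarith, le_rfl, hpP⟩
    · exact ⟨B, B + L, by ring, le_rfl, hBb, by linarith, by linarith⟩
  have hR₁o : IsOpen R₁ := isOpen_Ioo.reProdIm isOpen_Ioo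
  have hR₂o : IsOpen R₂ := isOpen_Ioo.reProdIm isOpen_Ioo
  have hSo : IsOpen S := isOpen_Ioo.reProdIm isOpen_Ioo
  have hR₂c : Convex ℝ R₂ := ((convex_Ioo _ _).linear_preimage Complex.reLm).inter
    ((convex_Ioo _ _).linear_preimage Complex.imLm)
  have hSc : Convex ℝ S := ((convex_Ioo _ _).linear_preimage Complex.reLm).inter
    ((convex_Ioo _ _).linear_preimage Complex.imLm)
  have hR₁S : R₁ ⊆ S := fun z hz =>
    ⟨hz.1, lt_of_le_of_lt hBb hz.2.1, lt_of_lt_of_le hz.2.2 hpP⟩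
  have hg : IsFlatOn ω G R₁ := hG.mono hR₁S
  have hGi : InjOn G R₁ := (hgG.injOn_iff).2 hgi
  have himg : ∀ V, MeasurableSet V → MeasurableSet (R₂ ∩ f ⁻¹' (G '' (R₁ ∩ V))) := fun V hV =>
    hf.1.measurableSet_inter_preimage hR₂o.measurableSet
      (hg.measurableSet_image (hR₁o.measurableSet.inter hV) inter_subset_left
        (hGi.mono inter_subset_left))
  rw [← hgG.image_eq]
  -- `Y` is the part of `R₂` that `f` maps into the first rectangle, and `w` its position there
  set Y : Set ℂ := R₂ ∩ f ⁻¹' (G '' R₁) with hYdef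
  have hYm : MeasurableSet Y := by simpa using himg univ MeasurableSet.univ
  set w : ℂ → ℂ := fun z => Function.invFunOn G R₁ (f z)
  have hw : ∀ z ∈ Y, w z ∈ R₁ ∧ G (w z) = f z := fun z hz =>
    ⟨Function.invFunOn_mem hz.2, Function.invFunOn_eq hz.2⟩
  set H : ℂ → ℝ := Y.indicator fun z => (w z).im
  have hH : Measurable H := by
    intro V hV
    rw [indicator_preimage, Set.ite]
    refine MeasurableSet.union ?_ ((measurable_zero hV).diff hYm)
    convert himg _ (Complex.measurable_im hV) using 1
    ext z
    constructor
    · rintro ⟨hzV, hzY⟩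
      exact ⟨hzY.1, w z, ⟨(hw z hzY).1, hzV⟩, (hw z hzY).2⟩
    · rintro ⟨hz, v, ⟨hv, hvV⟩, hvz⟩
      have hzY : z ∈ Y := ⟨hz, v, hv, hvz⟩
      have : w z = v := hGi (hw z hzY).1 hv ((hw z hzY).2.trans hvz.symm)
      exact ⟨by simpa [this] using hvV, hzY⟩
  set Y' : Set ℂ := Y ∩ {z | b₂ < z.im - L ∧ z.im + L < p₂} with hY'
  have hY'm : MeasurableSet Y' := hYm.inter
    ((measurableSet_lt (f := fun _ : ℂ => b₂) (g := fun z : ℂ => z.im - L) (by fun_prop)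
      (by fun_prop)).inter (measurableSet_lt (f := fun z : ℂ => z.im + L) (g := fun _ => p₂)
        (by fun_prop) (by fun_prop)))
  set W : Set (ℂ × ℝ) := {q | q.1 ∈ Y' ∧ s₀ < H q.1 + q.2 ∧ H q.1 + q.2 < s₁} with hW
  have hHp : Measurable fun q : ℂ × ℝ => H q.1 + q.2 := (hH.comp measurable_fst).add measurable_snd
  have hWm : MeasurableSet W := (measurable_fst hY'm).inter
    ((measurableSet_lt measurable_const hHp).inter (measurableSet_lt hHp measurable_const))
  have hHw : ∀ z ∈ Y', H z = (w z).im := fun z hz => indicator_of_mem hz.1 _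
  have hmain : ENNReal.ofReal L * volume Y' ≤ ENNReal.ofReal (2 * (p₁ - b₁)) * volume R₂ := by
    refine volume_shear_le hWm hR₂o.measurableSet hY'm (fun z hz => ?_) (fun z hz => ?_)
      fun z hz => ?_
    · have : Ioo (s₀ - H z) (s₁ - H z) ⊆ {u : ℝ | (z, u) ∈ W} := fun u hu =>
        ⟨hz, by linarith [hu.1], by linarith [hu.2]⟩
      refine le_trans (le_of_eq ?_) (measure_mono this)
      rw [Real.volume_Ioo, ← hs]
      congr 1
      ring
    · have hfin : {q ∈ S | G q = f z}.Finite :=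
        finite_of_encard_le_coe (k := 2) (hG2 (f z))
      -- each position `q` of the endpoint `f z` in the extended rectangle allows an interval of `u`
      have hsub : {u : ℝ | (z - u * Complex.I, u) ∈ W} ⊆
          ⋃ q ∈ hfin.toFinset, Ioo (q.im - p₁) (q.im - b₁) := by
        rintro u ⟨hzu, h₀, h₁⟩
        simp only [hHw _ hzu] at h₀ h₁
        obtain ⟨hv, hGv⟩ := hw _ hzu.1
        set v := w (z - u * Complex.I)
        have hvS : v + u * Complex.I ∈ S := by
          refine ⟨by simpa using hv.1, ?_⟩
          simp only [mem_preimage, Complex.add_im, Complex.mul_im, Complex.ofReal_re,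
            Complex.I_im, Complex.ofReal_im, Complex.I_re, mul_one, mul_zero, add_zero]
          exact ⟨by linarith, by linarith⟩
        have hflow := hf.apply_add_eq hG hR₂o hSo hR₂c hSc hzu.1.1 (hR₁S hv) hGv.symm
          (v := u * Complex.I) (by simpa using hz) hvS
        rw [sub_add_cancel] at hflow
        refine mem_biUnion (x := v + u * Complex.I) (by simpa using ⟨hvS, hflow.symm⟩) ?_
        have h1 := hv.2.1
        have h2 := hv.2.2
        constructor <;> simp <;> linarith
      refine (measure_mono hsub).trans ((measure_biUnion_finset_le _ _).trans ?_)
      have hterm : ∀ q : ℂ, volume (Ioo (q.im - p₁) (q.im - b₁)) = ENNReal.ofReal (p₁ - b₁) := by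
        intro q
        rw [Real.volume_Ioo]
        congr 1
        ring
      rw [Finset.sum_congr rfl fun q _ => hterm q, Finset.sum_const, nsmul_eq_mul,
        ENNReal.ofReal_mul zero_le_two, ENNReal.ofReal_ofNat]
      gcongr
      have h2 := hG2 (f z)
      rw [hfin.encard_eq_coe_toFinset_card] at h2
      exact_mod_cast h2
    · refine eq_empty_of_forall_notMem fun u hu => hz ?_
      obtain ⟨hzu, h₀, h₁⟩ := hu
      simp only [hHw _ hzu] at h₀ h₁
      have hv := (hw _ hzu.1).1
      have h1 := hv.2.1
      have h2 := hv.2.2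
      have h3 := hzu.2.1
      have h4 := hzu.2.2
      simp only [Complex.sub_im, Complex.mul_im, Complex.ofReal_re,
            Complex.I_im, Complex.ofReal_im, Complex.I_re, mul_one, mul_zero, add_zero] at h3 h4
      exact ⟨by simpa using hzu.1.1.1, by linarith, by linarith⟩
  have hYimg : G '' R₁ ∩ f '' R₂ = f '' Y := by
    rw [hYdef, image_inter_preimage, inter_comm]
  rw [hYimg, hf.flatArea_image_eq hYm inter_subset_left (hfi.mono inter_subset_left)]
  have hedge : Y ⊆ Y' ∪ ((Ioo l₂ r₂ ×ℂ Ioc b₂ (b₂ + L)) ∪ (Ioo l₂ r₂ ×ℂ Ico (p₂ - L) p₂)) := by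
    intro z hz
    by_cases h1 : b₂ < z.im - L
    · by_cases h2 : z.im + L < p₂
      · exact Or.inl ⟨hz, h1, h2⟩
      · exact Or.inr (Or.inr ⟨hz.1.1, by linarith, hz.1.2.2⟩)
    · exact Or.inr (Or.inl ⟨hz.1.1, hz.1.2.1, by linarith⟩)
  have hvolY : volume Y ≤ volume Y' + ENNReal.ofReal (2 * ((r₂ - l₂) * L)) := by
    refine (measure_mono hedge).trans ((measure_union_le _ _).trans ?_)
    gcongr
    refine (measure_union_le _ _).trans (le_of_eq ?_)
    simp only [Complex.volume_reProdIm, Real.volume_Ioo, Real.volume_Ioc, Real.volume_Ico]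
    rw [add_sub_cancel_left, sub_sub_cancel, ← two_mul, ← ENNReal.ofReal_mul (by linarith),
      ENNReal.ofReal_mul zero_le_two, ENNReal.ofReal_ofNat]
  calc ENNReal.ofReal L * volume Y
      ≤ ENNReal.ofReal L * (volume Y' + ENNReal.ofReal (2 * ((r₂ - l₂) * L))) := by gcongr
    _ ≤ ENNReal.ofReal (2 * (p₁ - b₁)) * volume R₂ +
        ENNReal.ofReal L * ENNReal.ofReal (2 * ((r₂ - l₂) * L)) := by
        rw [mul_add]
        gcongr
    _ = _ := by
        have e1 : 0 ≤ 2 * (p₁ - b₁) := by linarith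
        have e2 : 0 ≤ r₂ - l₂ := by linarith
        have e3 : 0 ≤ p₂ - b₂ := by linarith
        rw [hR₂, Complex.volume_reProdIm, Real.volume_Ioo, Real.volume_Ioo,
          ← ENNReal.ofReal_mul e2, ← ENNReal.ofReal_mul e1, ← ENNReal.ofReal_mul hL0,
          ← ENNReal.ofReal_add (by positivity) (by positivity)]

end Overlap

/-! ### Rectangles of the Teichmüller geodesic -/

section Rectangles

/-- The real-linear map `x + i y ↦ a x + i b y`. -/
noncomputable def scaleReIm (a b : ℝ) : ℂ →L[ℝ] ℂ :=
  (a • Complex.reCLM).smulRight (1 : ℂ) + (b • Complex.imCLM).smulRight Complex.I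

theorem scaleReIm_apply (a b : ℝ) (z : ℂ) : scaleReIm a b z = ⟨a * z.re, b * z.im⟩ := by
  apply Complex.ext <;> simp [scaleReIm]

theorem coe_teichmullerLinear (t : ℝ) :
    ⇑(teichmullerLinear t) = scaleReIm (Real.exp (t / 2)) (Real.exp (-t / 2)) :=
  funext fun z => (scaleReIm_apply _ _ z).symm

theorem coe_teichmullerLinear_symm (t : ℝ) :
    ⇑(teichmullerLinear t).symm = scaleReIm (Real.exp (-t / 2)) (Real.exp (t / 2)) :=
  funext fun z => (scaleReIm_apply _ _ z).symm

theorem exp_neg_half_mul_exp_half (t : ℝ) : Real.exp (-t / 2) * Real.exp (t / 2) = 1 := by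
  rw [← Real.exp_add, ← Real.exp_zero]
  congr 1
  ring

theorem exp_neg_half (t : ℝ) : Real.exp (-t / 2) = (Real.exp (t / 2))⁻¹ :=
  eq_inv_of_mul_eq_one_left (exp_neg_half_mul_exp_half t)

theorem teichmullerLinear_preimage_reProdIm (t a b c d : ℝ) :
    teichmullerLinear t ⁻¹' (Ioo a b ×ℂ Ioo c d) =
      Ioo (Real.exp (-t / 2) * a) (Real.exp (-t / 2) * b) ×ℂ
        Ioo (Real.exp (t / 2) * c) (Real.exp (t / 2) * d) := by
  have h := exp_neg_half t
  have hp := Real.exp_pos (t / 2)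
  ext z
  simp only [mem_preimage, Complex.mem_reProdIm, coe_teichmullerLinear, scaleReIm_apply, mem_Ioo, h]
  rw [inv_mul_lt_iff₀ hp, lt_inv_mul_iff₀ hp, lt_inv_mul_iff₀ hp, inv_mul_lt_iff₀ hp]

theorem measurableSet_of_Ioo_subset_of_subset_Icc {s : Set ℝ} {a b : ℝ} (h₁ : Ioo a b ⊆ s)
    (h₂ : s ⊆ Icc a b) : MeasurableSet s := by
  have h : (s \ Ioo a b).Finite := (toFinite {a, b}).subset fun x hx => by
    have := h₂ hx.1
    by_contra hne
    simp only [mem_insert_iff, mem_singleton_iff, not_or] at hne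
    exact hx.2 ⟨lt_of_le_of_ne this.1 (Ne.symm hne.1), lt_of_le_of_ne this.2 hne.2⟩
  rw [← union_sdiff_cancel h₁]
  exact measurableSet_Ioo.union h.measurableSet

variable {X : Type*} [TopologicalSpace X] [ChartedSpace ℂ X] {ω : HolomorphicOneForm X} {t t' : ℝ}

namespace FlatRectangle

/-- The rectangle `R` of `X_t`, read as a map to `X` on the rectangle of the plane that
`z ↦ e^{t/2} Re z + i e^{-t/2} Im z` maps to the domain of `R`. -/
noncomputable def toSurface (R : FlatRectangle ω t) (z : ℂ) : X :=
  (teichmullerMap ω t).symm (R.toFun (teichmullerLinear t z))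

/-- The open rectangle of sides `width` and `height`, the interior of `R.domain`. -/
def openDomain (R : FlatRectangle ω t) : Set ℂ := Ioo R.left R.right ×ℂ Ioo R.bottom R.top

theorem openDomain_subset_domain (R : FlatRectangle ω t) : R.openDomain ⊆ R.domain :=
  fun _ hz => ⟨R.Ioo_subset_hor hz.1, R.Ioo_subset_ver hz.2⟩

theorem openDomain_subset_interior (R : FlatRectangle ω t) : R.openDomain ⊆ interior R.domain :=
  interior_maximal R.openDomain_subset_domain (isOpen_Ioo.reProdIm isOpen_Ioo)

theorem measurableSet_domain (R : FlatRectangle ω t) : MeasurableSet R.domain :=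
  (Complex.measurable_re
    (measurableSet_of_Ioo_subset_of_subset_Icc R.Ioo_subset_hor R.hor_subset_Icc)).inter
  (Complex.measurable_im
    (measurableSet_of_Ioo_subset_of_subset_Icc R.Ioo_subset_ver R.ver_subset_Icc))

theorem isFlatOn_toSurface (R : FlatRectangle ω t) :
    IsFlatOn ω R.toSurface (teichmullerLinear t ⁻¹' R.domain) := by
  refine ⟨(teichmullerMap ω t).symm.continuous.comp_continuousOn
    (R.continuousOn.comp (teichmullerLinear t).continuous.continuousOn (mapsTo_preimage _ _)),
    fun z hz => ?_⟩
  obtain ⟨ψ, ⟨φ, hφ, rfl⟩, hsrc, hd⟩ := R.pullback_eq _ hz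
  refine ⟨φ, hφ, by simpa [toSurface] using hsrc, ?_⟩
  have h₁ : HasFDerivWithinAt (teichmullerLinear t)
      (scaleReIm (Real.exp (t / 2)) (Real.exp (-t / 2))) (teichmullerLinear t ⁻¹' R.domain) z := by
    rw [coe_teichmullerLinear]
    exact (ContinuousLinearMap.hasFDerivAt _).hasFDerivWithinAt
  have h₂ := (hd.hasFDerivWithinAt.restrictScalars ℝ).comp z h₁ (mapsTo_preimage _ _)
  have h₃ := (scaleReIm (Real.exp (-t / 2)) (Real.exp (t / 2))).hasFDerivAt.comp_hasFDerivWithinAt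
    z h₂
  refine (h₃.congr ?_ ?_).congr_fderiv ?_
  · intro w _
    simp only [← coe_teichmullerLinear_symm, Function.comp_apply,
      OpenPartialHomeomorph.transHomeomorph_apply, Homeomorph.symm_apply_apply]
    rfl
  · simp only [← coe_teichmullerLinear_symm, Function.comp_apply,
      OpenPartialHomeomorph.transHomeomorph_apply, Homeomorph.symm_apply_apply]
    rfl
  · refine ContinuousLinearMap.ext fun v => ?_
    have h := exp_neg_half_mul_exp_half t
    refine Complex.ext ?_ ?_ <;> simp [scaleReIm_apply]
    · linear_combination v.re * h
    · linear_combination v.im * h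

theorem IsEmbedded.injOn_toSurface {R : FlatRectangle ω t} (hR : R.IsEmbedded) :
    InjOn R.toSurface (teichmullerLinear t ⁻¹' R.domain) := fun _ hz _ hw h =>
  (teichmullerLinear t).injective (hR hz hw ((teichmullerMap ω t).symm.injective h))

theorem preimage_image_eq (R : FlatRectangle ω t) :
    teichmullerMap ω t ⁻¹' R.image = R.toSurface '' (teichmullerLinear t ⁻¹' R.domain) := by
  rw [show R.toSurface = (teichmullerMap ω t).symm ∘ R.toFun ∘ teichmullerLinear t from rfl,
    image_comp, image_comp, image_preimage_eq _ (teichmullerLinear t).surjective,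
    (teichmullerMap ω t).image_symm]
  rfl

theorem volume_preimage_openDomain (R : FlatRectangle ω t) :
    volume (teichmullerLinear t ⁻¹' R.openDomain) = ENNReal.ofReal (R.width * R.height) := by
  have h := exp_neg_half_mul_exp_half t
  have hw := sub_pos.2 R.left_lt_right
  rw [openDomain, teichmullerLinear_preimage_reProdIm, Complex.volume_reProdIm, Real.volume_Ioo,
    Real.volume_Ioo, ← mul_sub, ← mul_sub, ← ENNReal.ofReal_mul (by positivity),
    mul_mul_mul_comm, h, one_mul, width, height]

theorem volume_preimage_domain_diff (R : FlatRectangle ω t) :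
    volume (teichmullerLinear t ⁻¹' R.domain \ teichmullerLinear t ⁻¹' R.openDomain) = 0 := by
  have hsub : teichmullerLinear t ⁻¹' R.domain \ teichmullerLinear t ⁻¹' R.openDomain ⊆
      ({Real.exp (-t / 2) * R.left, Real.exp (-t / 2) * R.right} ×ℂ univ) ∪
      (univ ×ℂ {Real.exp (t / 2) * R.bottom, Real.exp (t / 2) * R.top}) := by
    have h := exp_neg_half t
    have hp := Real.exp_pos (t / 2)
    rintro z ⟨hz, hz'⟩
    simp only [mem_preimage, coe_teichmullerLinear, scaleReIm_apply, domain, openDomain,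
      Complex.mem_reProdIm] at hz hz'
    have h1 := R.hor_subset_Icc hz.1
    have h2 := R.ver_subset_Icc hz.2
    by_contra hne
    simp only [mem_union, Complex.mem_reProdIm, mem_insert_iff, mem_singleton_iff, mem_univ,
      and_true, true_and, not_or] at hne
    obtain ⟨⟨n1, n2⟩, n3, n4⟩ := hne
    refine hz' ⟨⟨lt_of_le_of_ne h1.1 fun e => n1 ?_, lt_of_le_of_ne h1.2 fun e => n2 ?_⟩,
      ⟨lt_of_le_of_ne h2.1 fun e => n3 ?_, lt_of_le_of_ne h2.2 fun e => n4 ?_⟩⟩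
    · rw [e, h, inv_mul_cancel_left₀ hp.ne']
    · rw [← e, h, inv_mul_cancel_left₀ hp.ne']
    · rw [e, h, mul_inv_cancel_left₀ hp.ne']
    · rw [← e, h, mul_inv_cancel_left₀ hp.ne']
  refine measure_mono_null hsub (measure_union_null ?_ ?_)
  · rw [Complex.volume_reProdIm, (toFinite {_, _}).measure_zero, zero_mul]
  · rw [Complex.volume_reProdIm, (toFinite {_, _}).measure_zero, mul_zero]

theorem measurableSet_preimage_domain (R : FlatRectangle ω t) :
    MeasurableSet (teichmullerLinear t ⁻¹' R.domain) :=
  (teichmullerLinear t).continuous.measurable R.measurableSet_domain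

theorem measurableSet_preimage_openDomain (R : FlatRectangle ω t) :
    MeasurableSet (teichmullerLinear t ⁻¹' R.openDomain) :=
  (teichmullerLinear t).continuous.measurable (isOpen_Ioo.reProdIm isOpen_Ioo).measurableSet

theorem ExtendsVertically.bounds {S R : FlatRectangle ω t} (h : S.ExtendsVertically R) :
    S.left = R.left ∧ S.right = R.right ∧ S.bottom ≤ R.bottom ∧ R.top ≤ S.top := by
  have key : ∀ {a b c d : ℝ} {s : Set ℝ}, a < b → Ioo a b ⊆ s → s ⊆ Icc c d → c ≤ a ∧ b ≤ d :=
    fun hab h1 h2 => by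
      have := closure_minimal (h1.trans h2) isClosed_Icc
      rw [closure_Ioo hab.ne] at this
      exact (Icc_subset_Icc_iff hab.le).1 this
  have h1 := key R.left_lt_right R.Ioo_subset_hor (h.1 ▸ S.hor_subset_Icc)
  have h2 := key S.left_lt_right (h.1 ▸ S.Ioo_subset_hor) R.hor_subset_Icc
  have h3 := key R.bottom_lt_top R.Ioo_subset_ver (h.2.1.trans S.ver_subset_Icc)
  exact ⟨h1.1.antisymm h2.1, h2.2.antisymm h1.2, h3⟩

section Area

variable [T2Space X] [MeasurableSpace X] [BorelSpace X]

theorem IsEmbedded.measurableSet_preimage_image {R : FlatRectangle ω t} (hR : R.IsEmbedded) :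
    MeasurableSet (teichmullerMap ω t ⁻¹' R.image) := by
  rw [R.preimage_image_eq]
  exact R.isFlatOn_toSurface.measurableSet_image R.measurableSet_preimage_domain subset_rfl
    hR.injOn_toSurface

variable [SecondCountableTopology X]

theorem IsEmbedded.flatArea_preimage_image {R : FlatRectangle ω t} (hR : R.IsEmbedded) :
    flatArea ω (teichmullerMap ω t ⁻¹' R.image) = ENNReal.ofReal (R.width * R.height) := by
  rw [R.preimage_image_eq, R.isFlatOn_toSurface.flatArea_image_eq R.measurableSet_preimage_domain
    subset_rfl hR.injOn_toSurface, ← R.volume_preimage_openDomain]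
  refine le_antisymm ?_ (measure_mono (preimage_mono R.openDomain_subset_domain))
  exact (measure_le_inter_add_sdiff _ _ _).trans
    (by rw [R.volume_preimage_domain_diff, add_zero]; exact measure_mono inter_subset_right)

/-- The boundary of an embedded rectangle is a null set. -/
theorem IsEmbedded.flatArea_diff_openDomain {R : FlatRectangle ω t} (hR : R.IsEmbedded) :
    flatArea ω ((teichmullerMap ω t ⁻¹' R.image) \
      R.toSurface '' (teichmullerLinear t ⁻¹' R.openDomain)) = 0 := by
  rw [R.preimage_image_eq]
  rw [← hR.injOn_toSurface.image_sdiff_subset (preimage_mono R.openDomain_subset_domain),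
    R.isFlatOn_toSurface.flatArea_image_eq (R.measurableSet_preimage_domain.diff
    R.measurableSet_preimage_openDomain) sdiff_subset (hR.injOn_toSurface.mono sdiff_subset),
    R.volume_preimage_domain_diff]

/-- The overlap bound `flatArea_image_inter_le` in terms of the sides of the rectangles in `X_t` and
`X_{t'}`. Both are read in the flat metric of `X`, where heights in `X_t` are multiplied by `e^{t/2}`
and widths in `X_{t'}` by `e^{-t'/2}`. -/
theorem flatArea_inter_le_of_extendsVertically {R S : FlatRectangle ω t} {R' : FlatRectangle ω t'}
    (hR : R.IsEmbedded) (hR' : R'.IsEmbedded) (hS : S.ExtendsVertically R)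
    (hS2 : S.OverlapsAtMostOnce) {M : ℝ} (hRM : R.height ≤ M) (hMS : M ≤ S.height) :
    flatArea ω ((teichmullerMap ω t ⁻¹' R.image) ∩ (teichmullerMap ω t' ⁻¹' R'.image)) ≤
      ENNReal.ofReal (2 * R.height / M * (R'.width * R'.height) +
        2 * Real.exp (-(t' - t) / 2) * R'.width * M) := by
  obtain ⟨hl, hr, hb, hp⟩ := hS.bounds
  have hM : 0 < M := (sub_pos.2 R.bottom_lt_top).trans_le hRM
  have e1 : teichmullerLinear t ⁻¹' R.openDomain = _ := teichmullerLinear_preimage_reProdIm t _ _ _ _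
  have e2 : teichmullerLinear t' ⁻¹' R'.openDomain = _ :=
    teichmullerLinear_preimage_reProdIm t' _ _ _ _
  have e3 : teichmullerLinear t ⁻¹' S.openDomain = _ := teichmullerLinear_preimage_reProdIm t _ _ _ _
  have hsubR := preimage_mono (f := teichmullerLinear t) R.openDomain_subset_domain
  have hsubS := preimage_mono (f := teichmullerLinear t) S.openDomain_subset_domain
  have hsubR' := preimage_mono (f := teichmullerLinear t') R'.openDomain_subset_domain
  have hopen : flatArea ω ((teichmullerMap ω t ⁻¹' R.image) ∩
      (teichmullerMap ω t' ⁻¹' R'.image)) ≤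
      flatArea ω (R.toSurface '' (teichmullerLinear t ⁻¹' R.openDomain) ∩
        R'.toSurface '' (teichmullerLinear t' ⁻¹' R'.openDomain)) := by
    have hsub : (teichmullerMap ω t ⁻¹' R.image) ∩ (teichmullerMap ω t' ⁻¹' R'.image) ⊆
        (R.toSurface '' (teichmullerLinear t ⁻¹' R.openDomain) ∩
          R'.toSurface '' (teichmullerLinear t' ⁻¹' R'.openDomain)) ∪
        (((teichmullerMap ω t ⁻¹' R.image) \
          R.toSurface '' (teichmullerLinear t ⁻¹' R.openDomain)) ∪
        ((teichmullerMap ω t' ⁻¹' R'.image) \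
          R'.toSurface '' (teichmullerLinear t' ⁻¹' R'.openDomain))) := by
      rintro x ⟨hx, hx'⟩
      by_cases h1 : x ∈ R.toSurface '' (teichmullerLinear t ⁻¹' R.openDomain)
      · by_cases h2 : x ∈ R'.toSurface '' (teichmullerLinear t' ⁻¹' R'.openDomain)
        · exact Or.inl ⟨h1, h2⟩
        · exact Or.inr (Or.inr ⟨hx', h2⟩)
      · exact Or.inr (Or.inl ⟨hx, h1⟩)
    refine (measure_mono hsub).trans ((measure_union_le _ _).trans ?_)
    rw [measure_union_null hR.flatArea_diff_openDomain hR'.flatArea_diff_openDomain, add_zero]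
  refine hopen.trans ?_
  have hG2 : ∀ x, {z ∈ teichmullerLinear t ⁻¹' S.openDomain | S.toSurface z = x}.encard ≤ 2 := by
    intro x
    refine le_trans ?_ (hS2 (teichmullerMap ω t x))
    rw [← (teichmullerLinear t).injective.encard_image]
    refine encard_le_encard ?_
    rintro _ ⟨z, ⟨hz, rfl⟩, rfl⟩
    exact ⟨S.openDomain_subset_interior hz, ((teichmullerMap ω t).apply_symm_apply _).symm⟩
  have hgG : EqOn S.toSurface R.toSurface (teichmullerLinear t ⁻¹' R.openDomain) := fun z hz =>
    congrArg (teichmullerMap ω t).symm (hS.2.2 (R.openDomain_subset_domain hz))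
  rw [hl, hr] at e3
  have hf := R'.isFlatOn_toSurface.mono hsubR'
  have hfi := hR'.injOn_toSurface.mono hsubR'
  have hG := S.isFlatOn_toSurface.mono hsubS
  have hgi := hR.injOn_toSurface.mono hsubR
  rw [e1] at hgG hgi ⊢
  rw [e2] at hf hfi ⊢
  rw [e3] at hG hG2
  have hmain := flatArea_image_inter_le (L := Real.exp (t / 2) * M) hf hfi hG hgi hgG
    (by gcongr) (by gcongr) hG2 (by gcongr; exact R'.left_lt_right.le)
    (by gcongr; exact R'.bottom_lt_top.le) (by gcongr; exact R.bottom_lt_top.le)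
    (by rw [← mul_sub]; gcongr; exact hRM) (by rw [← mul_sub]; gcongr; exact hMS)
  have hL : 0 < Real.exp (t / 2) * M := by positivity
  refine (ENNReal.mul_le_mul_iff_right (ENNReal.ofReal_pos.2 hL).ne' ENNReal.ofReal_ne_top).1 ?_
  refine hmain.trans (le_of_eq ?_)
  rw [← ENNReal.ofReal_mul hL.le]
  congr 1
  have h' : Real.exp (-(t' - t) / 2) = Real.exp (-t' / 2) * Real.exp (t / 2) := by
    rw [← Real.exp_add]
    congr 1
    ring
  have hq : R.height / M * M = R.height := div_mul_cancel₀ _ hM.ne'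
  rw [h', mul_div_assoc]
  simp only [← mul_sub]
  rw [← show R.height = R.top - R.bottom from rfl, ← show R'.height = R'.top - R'.bottom from rfl,
    ← show R'.width = R'.right - R'.left from rfl]
  linear_combination (2 * R.height * R'.width * R'.height * Real.exp (t / 2)) *
    exp_neg_half_mul_exp_half t' - (2 * R'.width * R'.height * Real.exp (t / 2)) * hq

end Area

end FlatRectangle

end Rectangles

/-! ### Sparse times with divergent sum of reciprocals -/

section Times

/-- By Cauchy condensation the series compares with the harmonic series. -/
theorem not_summable_one_div_mul_log (N : ℕ) (hN : 1 ≤ N) {C : ℝ} (hC : 0 < C) :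
    ¬ Summable fun n : ℕ => 1 / (C * (((n : ℝ) + N) * Real.log ((n : ℝ) + N))) := by
  have hN' : (1 : ℝ) ≤ N := by exact_mod_cast hN
  have hlog : ∀ n : ℕ, 0 ≤ Real.log ((n : ℝ) + N) := fun n =>
    Real.log_nonneg (by linarith [n.cast_nonneg (α := ℝ)])
  have hlogpos : ∀ n : ℕ, 0 < n → 0 < Real.log ((n : ℝ) + N) := fun n hn =>
    Real.log_pos (by
      have : (0 : ℝ) < n := by exact_mod_cast hn
      linarith)
  rw [← summable_condensed_iff_of_nonneg]
  · intro h
    have hA : 0 < C * ((1 + N) * Real.log (1 + N)) := by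
      have : 0 < Real.log (1 + (N : ℝ)) := Real.log_pos (by linarith)
      positivity
    refine Real.not_summable_one_div_natCast ((summable_nat_add_iff 1).1 ?_)
    refine Summable.of_nonneg_of_le (fun k => by positivity) (fun k => ?_)
      (h.mul_left (C * ((1 + N) * Real.log (1 + N))))
    have h2k : (1 : ℝ) ≤ 2 ^ k := one_le_pow₀ (by norm_num)
    have hx : (2 : ℝ) ^ k + N ≤ 2 ^ k * (1 + N) := by nlinarith
    have hlog2 : Real.log ((2 : ℝ) ^ k + N) ≤ (k + 1) * Real.log (1 + N) := by
      refine (Real.log_le_log (by positivity) hx).trans ?_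
      rw [Real.log_mul (by positivity) (by positivity), Real.log_pow]
      have : Real.log 2 ≤ Real.log (1 + N) := Real.log_le_log (by norm_num) (by linarith)
      nlinarith [k.cast_nonneg (α := ℝ)]
    have hpos := hlogpos (2 ^ k) (by positivity)
    push_cast at hpos ⊢
    rw [← mul_assoc, mul_one_div, div_le_div_iff₀ (by positivity) (by positivity), one_mul]
    calc C * (((2 : ℝ) ^ k + N) * Real.log (2 ^ k + N))
        ≤ C * ((2 ^ k * (1 + N)) * ((k + 1) * Real.log (1 + N))) := by gcongr
      _ = _ := by ring
  · intro n
    have := hlog n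
    positivity
  · intro m n hm hmn
    have h1 := hlogpos m hm
    have h2 : (m : ℝ) ≤ n := by exact_mod_cast hmn
    gcongr

/-- The times `t n = 12 x log x`, `x = n + N`, grow by at least `4 log t` at every step, but slowly
enough for `∑ 1 / t n` to diverge. -/
theorem exists_sparse_times (T : ℝ) : ∃ t : ℕ → ℝ, (∀ n, T < t n) ∧ (∀ n, 1 ≤ t n) ∧
    Tendsto t atTop atTop ∧ (∀ n m, n < m → 4 * Real.log (t m) ≤ t m - t n) ∧
    ¬ Summable fun n => 1 / t n := by
  obtain ⟨N, hN⟩ := exists_nat_gt (max T 12)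
  have hNT : T < N := (le_max_left _ _).trans_lt hN
  have hN12 : (12 : ℝ) < N := (le_max_right _ _).trans_lt hN
  have hlog : ∀ n : ℕ, 1 ≤ Real.log ((n : ℝ) + N) := fun n => by
    have h3 : (3 : ℝ) ≤ (n : ℝ) + N := by linarith [n.cast_nonneg (α := ℝ)]
    rw [Real.le_log_iff_exp_le (by linarith)]
    linarith [Real.exp_one_lt_d9]
  set t : ℕ → ℝ := fun n => 12 * (((n : ℝ) + N) * Real.log ((n : ℝ) + N)) with ht
  have hge : ∀ n : ℕ, (n : ℝ) + N ≤ t n := fun n => by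
    have h1 := hlog n
    have h2 := n.cast_nonneg (α := ℝ)
    simp only [ht]
    nlinarith
  have hstep : ∀ n, 4 * Real.log (t (n + 1)) ≤ t (n + 1) - t n := by
    intro n
    have h2 := n.cast_nonneg (α := ℝ)
    have hy := hlog (n + 1)
    push_cast at hy
    have hpos : 0 < (n : ℝ) + 1 + N := by linarith
    have hxy : Real.log ((n : ℝ) + N) ≤ Real.log ((n : ℝ) + 1 + N) :=
      Real.log_le_log (by linarith) (by linarith)
    have h12 : Real.log 12 ≤ Real.log ((n : ℝ) + 1 + N) :=
      Real.log_le_log (by norm_num) (by linarith)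
    have hll : Real.log (Real.log ((n : ℝ) + 1 + N)) ≤ Real.log ((n : ℝ) + 1 + N) :=
      Real.log_le_self (by linarith)
    have e : Real.log (t (n + 1)) = Real.log 12 + (Real.log ((n : ℝ) + 1 + N) +
        Real.log (Real.log ((n : ℝ) + 1 + N))) := by
      simp only [ht]
      push_cast
      rw [Real.log_mul (by norm_num) (by positivity), Real.log_mul (by positivity) (by positivity)]
    have hd : 12 * Real.log ((n : ℝ) + 1 + N) ≤ t (n + 1) - t n := by
      simp only [ht]
      push_cast
      nlinarith
    linarith
  have h1 : ∀ n, 1 ≤ t n := fun n => by linarith [hge n, n.cast_nonneg (α := ℝ)]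
  have hmono : Monotone t := monotone_nat_of_le_succ fun n => by
    linarith [hstep n, Real.log_nonneg (h1 (n + 1))]
  refine ⟨t, fun n => by linarith [hge n, n.cast_nonneg (α := ℝ)], h1, ?_, ?_, ?_⟩
  · exact tendsto_atTop_mono (fun n => le_trans (by linarith) (hge n)) tendsto_natCast_atTop_atTop
  · intro n m hnm
    obtain ⟨k, rfl⟩ := Nat.exists_eq_succ_of_ne_zero (Nat.ne_zero_of_lt hnm)
    linarith [hstep k, hmono (Nat.lt_succ_iff.1 hnm)]
  · exact not_summable_one_div_mul_log N (by exact_mod_cast (by linarith : (1 : ℝ) ≤ N))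
      (by norm_num)

end Times

/-! ### The Paley-Zygmund conditions -/

theorem proposition4p3 (c δ : ℝ) (hc : 0 < c) (hδ : 0 < δ) :
    ∃ K : ℝ, 0 < K ∧
      ∀ (X : Type*) [TopologicalSpace X] [T2Space X] [CompactSpace X] [ConnectedSpace X]
        [ChartedSpace ℂ X] [IsManifold 𝓘(ℂ) 1 X] [MeasurableSpace X] [BorelSpace X]
        (ω : HolomorphicOneForm X), flatArea ω univ = 1 →
      ∀ (ε : ℝ), 0 < ε → ε ≤ 1 →
      ∀ (T : ℝ), 0 ≤ T →
      ∀ (A : ∀ t : Ioi T, FlatRectangle ω t),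
        (∀ t : Ioi T, (A t).IsSquare ∧ (A t).IsEmbedded ∧ (A t).IsBuffered δ ∧
          c / (t : ℝ) ^ (ε / 2) < (A t).width) →
      ∃ t : ℕ → Ioi T, Tendsto (fun n => (t n : ℝ)) atTop atTop ∧
        PaleyZygmundConditions (flatArea ω) K
          (fun n => teichmullerMap ω (t n) ⁻¹' (A (t n)).image) := by
  refine ⟨2 / δ + 2 * max 1 δ / c ^ 4, by positivity, ?_⟩
  intro X _ _ _ _ _ _ _ _ ω harea ε _ hε1 T _ A hA
  have : SecondCountableTopology X := ChartedSpace.secondCountable_of_sigmaCompact ℂ X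
  obtain ⟨t, htT, ht1, htop, hgap, hsum⟩ := exists_sparse_times T
  set s : ℕ → Ioi T := fun n => ⟨t n, htT n⟩
  set σ : ℕ → ℝ := fun n => (A (s n)).width with hσdef
  have hheight : ∀ n, (A (s n)).height = σ n := fun n => (hA (s n)).1.symm
  have hσ : ∀ n, 0 < σ n := fun n => sub_pos.2 (A (s n)).left_lt_right
  have hcσ : ∀ n, c ≤ σ n * √(t n) := by
    intro n
    have ht0 : 0 < t n := by linarith [ht1 n]
    have h := ((div_lt_iff₀ (Real.rpow_pos_of_pos ht0 _)).1 (hA (s n)).2.2.2).le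
    refine h.trans ?_
    rw [Real.sqrt_eq_rpow]
    exact mul_le_mul_of_nonneg_left
      (Real.rpow_le_rpow_of_exponent_le (ht1 n) (by linarith)) (hσ n).le
  have hareaE : ∀ n, flatArea ω (teichmullerMap ω (s n) ⁻¹' (A (s n)).image) =
      ENNReal.ofReal (σ n ^ 2) := fun n => by
    rw [(hA (s n)).2.1.flatArea_preimage_image, hheight, sq]
  have hσ1 : ∀ n, σ n ≤ 1 := by
    intro n
    have h : ENNReal.ofReal (σ n ^ 2) ≤ 1 := by
      rw [← hareaE, ← harea]
      exact measure_mono (subset_univ _)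
    rw [ENNReal.ofReal_le_one] at h
    nlinarith [hσ n]
  refine ⟨s, htop, fun n => (hA (s n)).2.1.measurableSet_preimage_image, fun n m hnm => ?_, ?_⟩
  · obtain ⟨S, hS, hS2, hSδ⟩ := (hA (s n)).2.2.1
    obtain ⟨hl, hr, hb, hp⟩ := hS.bounds
    have hSw : S.width = σ n := by simp only [FlatRectangle.width, hσdef, hl, hr]
    rw [hSw] at hSδ
    have hn := hσ n
    have hm := hσ m
    set M := max (σ n) (δ / σ n) with hM
    have hM0 : 0 < M := lt_max_of_lt_left hn
    have hMS : M ≤ S.height := by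
      refine max_le ?_ (by rwa [div_le_iff₀' hn])
      rw [← hheight n]
      simp only [FlatRectangle.height]
      linarith
    have hbound := FlatRectangle.flatArea_inter_le_of_extendsVertically (hA (s n)).2.1
      (hA (s m)).2.1 hS hS2 ((hheight n).trans_le (le_max_left _ _)) hMS
    refine hbound.trans ?_
    simp only [hareaE, hheight]
    rw [← ENNReal.ofReal_mul (by positivity), ← ENNReal.ofReal_mul (by positivity)]
    refine ENNReal.ofReal_le_ofReal ?_
    -- the time in the square is a proportion `σ / M ≤ σ² / δ` of the time in the buffer
    have h1 : 2 * σ n / M * (σ m * σ m) ≤ 2 / δ * (σ n ^ 2 * σ m ^ 2) := by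
      have hq : σ n / M ≤ σ n ^ 2 / δ := by
        rw [div_le_div_iff₀ hM0 hδ]
        have : δ ≤ M * σ n := (div_le_iff₀ hn).1 (le_max_right _ _)
        nlinarith
      calc 2 * σ n / M * (σ m * σ m) = 2 * (σ n / M) * σ m ^ 2 := by ring
        _ ≤ 2 * (σ n ^ 2 / δ) * σ m ^ 2 := by gcongr
        _ = _ := by ring
    -- the gap between the times makes the boundary term negligible
    have h2 : 2 * Real.exp (-(t m - t n) / 2) * σ m * M ≤
        2 * max 1 δ / c ^ 4 * (σ n ^ 2 * σ m ^ 2) := by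
      have htm : 0 < t m := by linarith [ht1 m]
      have hlt : t n ≤ t m := by linarith [hgap n m hnm, Real.log_nonneg (ht1 m)]
      have hM' : M ≤ max 1 δ / σ n := by
        refine max_le ?_ (by gcongr; exact le_max_right _ _)
        rw [le_div_iff₀ hn]
        have := hσ1 n
        have := le_max_left 1 δ
        nlinarith
      have hexp : Real.exp (-(t m - t n) / 2) ≤ 1 / t m ^ 2 := by
        rw [le_div_iff₀ (by positivity), ← Real.exp_log (pow_pos htm 2), ← Real.exp_add,
          Real.exp_le_one_iff, Real.log_pow]
        push_cast
        linarith [hgap n m hnm]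
      have hc4 : c ^ 4 ≤ σ n ^ 3 * σ m * t m ^ 2 := by
        have hcn : c ≤ σ n * √(t m) := (hcσ n).trans (by gcongr)
        calc c ^ 4 = c ^ 3 * c := by ring
          _ ≤ (σ n * √(t m)) ^ 3 * (σ m * √(t m)) := by gcongr; exact hcσ m
          _ = σ n ^ 3 * σ m * (√(t m) ^ 2) ^ 2 := by ring
          _ = _ := by rw [Real.sq_sqrt htm.le]
      have hD : 0 < max 1 δ := lt_max_of_lt_left one_pos
      calc 2 * Real.exp (-(t m - t n) / 2) * σ m * M
          ≤ 2 * (1 / t m ^ 2) * σ m * (max 1 δ / σ n) := by gcongr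
        _ = 2 * max 1 δ * σ m / σ n * (1 / t m ^ 2) := by ring
        _ ≤ 2 * max 1 δ * σ m / σ n * (σ n ^ 3 * σ m / c ^ 4) := by
            have h3 : 1 / t m ^ 2 ≤ σ n ^ 3 * σ m / c ^ 4 := by
              rw [div_le_div_iff₀ (by positivity) (by positivity)]
              linarith
            gcongr
        _ = _ := by field_simp
    calc _ ≤ 2 / δ * (σ n ^ 2 * σ m ^ 2) + 2 * max 1 δ / c ^ 4 * (σ n ^ 2 * σ m ^ 2) :=
          add_le_add h1 h2
      _ = _ := by ring
  · by_contra hfin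
    refine hsum ?_
    have h := ENNReal.summable_toReal hfin
    refine Summable.of_nonneg_of_le (fun n => by have := ht1 n; positivity) (fun n => ?_)
      (h.mul_left (c ^ 2)⁻¹)
    have ht0 : 0 < t n := by linarith [ht1 n]
    simp only [hareaE]
    rw [ENNReal.toReal_ofReal (sq_nonneg _), inv_mul_eq_div, div_le_div_iff₀ ht0 (by positivity),
      one_mul]
    calc c ^ 2 ≤ (σ n * √(t n)) ^ 2 := by gcongr; exact hcσ n
      _ = σ n ^ 2 * t n := by rw [mul_pow, Real.sq_sqrt ht0.le]
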